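/- A $2$-$(v,3,2)$ design is a pair $(X,\mathcal{B})$ where $X$ is a set of $v$ points and $\mathcal{B}$ is a set of $3$-element subsets of $X$ (called blocks) such that every $2$-element subset of $X$ is contained in exactly two blocks. For a block $B$ let $\mathbf{c}_B\in\{0,1\}^X\subseteq\mathbb{C}^X$ be its characteristic vector, let $\mathcal{I}(\mathcal{B})$ be the ideal of all polynomials in $\mathbb{C}[x_i : i\in X]$ that vanish at $\mathbf{c}_B$ for every $B\in\mathcal{B}$, and let $\gamma_2(\mathcal{B})$ be the smallest integer $s$ such that $\mathcal{I}(\mathcal{B})$ is generated by a set of polynomials all of which have degree at most $s$. **Theorem.** Suppose $v\equiv 1,3 \pmod 6$ and $v\ge 15$. Then there exists a $2$-$(v,3,2)$ design $(X,\mathcal{B})$ such that $\gamma_2(\mathcal{B})=3$. -/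

import Mathlib

/-- `blocks` is the block set of a `t`-`(v, k, l)` design on the finite point set `X`: there are
`v` points, every block is a `k`-subset of `X`, and every `t`-subset of `X` is contained in exactly
`l` blocks. The blocks form a set, so no block is repeated. -/
structure IsBlockDesign {X : Type*} [Fintype X] [DecidableEq X] (t v k l : ℕ)
    (blocks : Finset (Finset X)) : Prop where
  card_points : Fintype.card X = v
  card_block : ∀ B ∈ blocks, B.card = k
  card_through : ∀ T : Finset X, T.card = t → (blocks.filter (fun B => T ⊆ B)).card = l

/-- The zero-one vector of a block, with entry `1` exactly at the points of the block. -/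
def blockVector {X : Type*} [DecidableEq X] (B : Finset X) : X → ℂ :=
  fun i => if i ∈ B then 1 else 0

/-- The ideal of all complex polynomials, in variables indexed by the points, that vanish at the
vector of every block. -/
noncomputable def blockIdeal {X : Type*} [DecidableEq X] (blocks : Finset (Finset X)) :
    Ideal (MvPolynomial X ℂ) :=
  MvPolynomial.vanishingIdeal ℂ {c : X → ℂ | ∃ B ∈ blocks, c = blockVector B}

/-- `γ₂`: the smallest `s` such that the ideal of the blocks is generated by some set of
polynomials all of which have (total) degree at most `s`. -/
noncomputable def gammaTwo {X : Type*} [DecidableEq X] (blocks : Finset (Finset X)) : ℕ :=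
  sInf {s : ℕ | ∃ G : Set (MvPolynomial X ℂ),
    Ideal.span G = blockIdeal blocks ∧ ∀ f ∈ G, f.totalDegree ≤ s}

/-! Lower bound. Take an octahedron with antipodal pairs `a, x`, `b, y`, `c, z`, and sign its eight
faces so that adjacent faces have opposite signs. A monomial of degree at most two involves at most
two points, so it misses some antipodal pair; exchanging that pair matches faces of opposite sign,
and the signed sum of a quadratic over the faces is zero (`eval_octahedron`). If seven faces are
blocks and the eighth is not, every quadratic in the ideal also vanishes at the eighth face, while
the cubic monomial of that face lies in the ideal and does not. Cubics always suffice, so `γ₂ = 3`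
(`gammaTwo_eq_three`).

Existence. A system on `w` points extends to one on `2w + 1` or `2w + 7` points containing it, so a
punctured octahedron survives (`PuncturedOrder.extend`). The new points are the residues modulo an
even number `2m`. Triples among them use up the small differences, and the `w` remaining residues
label 2-regular graphs that are joined to the `w` old points. Explicit systems on 13, 15, 19, 21 and
25 points start the induction. -/

/-! ### The block ideal and octahedra -/

section PolynomialIdeal

open MvPolynomial

/-- Evaluating at the zero-one vector of `B` keeps exactly the monomials supported in `B`. -/
theorem eval_blockVector {V : Type*} [DecidableEq V] (B : Finset V) (f : MvPolynomial V ℂ) :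
    eval (blockVector B) f = ∑ m ∈ f.support, if m.support ⊆ B then f.coeff m else 0 := by
  rw [eval_eq]
  refine Finset.sum_congr rfl fun m _ => ?_
  split_ifs with h
  · rw [Finset.prod_eq_one, mul_one]
    intro i hi
    simp [blockVector, h hi]
  · obtain ⟨i, hi, hiB⟩ := Finset.not_subset.mp h
    rw [Finset.prod_eq_zero hi, mul_zero]
    simp [blockVector, hiB, Finsupp.mem_support_iff.mp hi]

theorem card_support_le_totalDegree {V : Type*} {f : MvPolynomial V ℂ} {m : V →₀ ℕ}
    (hm : m ∈ f.support) : m.support.card ≤ f.totalDegree := by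
  refine le_trans ?_ (le_totalDegree hm)
  rw [Finsupp.sum, Finset.card_eq_sum_ones]
  exact Finset.sum_le_sum fun i hi => Nat.one_le_iff_ne_zero.mpr (Finsupp.mem_support_iff.mp hi)

/-- A set of at most two points misses one of three disjoint pairs. -/
theorem exists_pair_disjoint {V : Type*} [DecidableEq V] {a b c x y z : V}
    (h : [a, b, c, x, y, z].Nodup) {S : Finset V} (hS : S.card ≤ 2) :
    (a ∉ S ∧ x ∉ S) ∨ (b ∉ S ∧ y ∉ S) ∨ (c ∉ S ∧ z ∉ S) := by
  have key : ∀ p q r : V, p ≠ q → p ≠ r → q ≠ r → p ∈ S → q ∈ S → r ∉ S := by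
    intro p q r hpq hpr hqr hp hq hr
    have h3 : ({p, q, r} : Finset V).card = 3 := Finset.card_eq_three.mpr
      ⟨p, q, r, hpq, hpr, hqr, rfl⟩
    have : ({p, q, r} : Finset V) ⊆ S := by
      intro t ht
      simp only [Finset.mem_insert, Finset.mem_singleton] at ht
      rcases ht with rfl | rfl | rfl <;> assumption
    have := Finset.card_le_card this
    omega
  simp only [List.nodup_cons, List.mem_cons, List.not_mem_nil, or_false, not_or] at h
  grind

/-- The alternating sum of a quadratic polynomial over the eight faces of an octahedron is zero. -/
theorem eval_octahedron {V : Type*} [DecidableEq V] {a b c x y z : V}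
    (h : [a, b, c, x, y, z].Nodup) {f : MvPolynomial V ℂ} (hf : f.totalDegree ≤ 2) :
    eval (blockVector {x, y, z}) f =
      eval (blockVector {a, b, c}) f + eval (blockVector {a, y, z}) f
        + eval (blockVector {b, x, z}) f + eval (blockVector {c, x, y}) f
        - eval (blockVector {b, c, x}) f - eval (blockVector {a, c, y}) f
        - eval (blockVector {a, b, z}) f := by
  simp only [eval_blockVector, ← Finset.sum_add_distrib, ← Finset.sum_sub_distrib]
  refine Finset.sum_congr rfl fun m hm => ?_
  have swap : ∀ (p q : V) (A B : Finset V), p ∉ m.support → q ∉ m.support →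
      (∀ t, t ≠ p → t ≠ q → (t ∈ A ↔ t ∈ B)) →
      (if m.support ⊆ A then f.coeff m else 0) = if m.support ⊆ B then f.coeff m else 0 := by
    intro p q A B hp hq hAB
    have : m.support ⊆ A ↔ m.support ⊆ B := forall₂_congr fun t ht =>
      hAB t (fun h => hp (h ▸ ht)) fun h => hq (h ▸ ht)
    simp only [this]
  -- The sum is compared monomial by monomial. Exchanging the antipodal pair that the monomial
  -- misses matches the eight faces in four cancelling pairs.
  rcases exists_pair_disjoint h ((card_support_le_totalDegree hm).trans hf) with
    ⟨h1, h2⟩ | ⟨h1, h2⟩ | ⟨h1, h2⟩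
  · rw [swap a x {a, b, c} {b, c, x} h1 h2 (by simp; tauto),
      swap a x {a, y, z} {x, y, z} h1 h2 (by simp; tauto),
      swap a x {a, c, y} {c, x, y} h1 h2 (by simp; tauto),
      swap a x {a, b, z} {b, x, z} h1 h2 (by simp; tauto)]
    ring
  · rw [swap b y {a, b, c} {a, c, y} h1 h2 (by simp; tauto),
      swap b y {b, x, z} {x, y, z} h1 h2 (by simp; tauto),
      swap b y {b, c, x} {c, x, y} h1 h2 (by simp; tauto),
      swap b y {a, b, z} {a, y, z} h1 h2 (by simp; tauto)]
    ring
  · rw [swap c z {a, b, c} {a, b, z} h1 h2 (by simp; tauto),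
      swap c z {c, x, y} {x, y, z} h1 h2 (by simp; tauto),
      swap c z {b, c, x} {b, x, z} h1 h2 (by simp; tauto),
      swap c z {a, c, y} {a, y, z} h1 h2 (by simp; tauto)]
    ring

theorem mem_blockIdeal {V : Type*} [DecidableEq V] {blocks : Finset (Finset V)}
    {f : MvPolynomial V ℂ} :
    f ∈ blockIdeal blocks ↔ ∀ B ∈ blocks, eval (blockVector B) f = 0 := by
  simp only [blockIdeal, mem_vanishingIdeal_iff, Set.mem_ofPred_eq, forall_exists_index, and_imp,
    aeval_eq_eval]
  exact ⟨fun h B hB => h _ B hB rfl, fun h c B hB hc => hc ▸ h B hB⟩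

theorem eval_prod_X_self {V : Type*} [DecidableEq V] (U : Finset V) :
    eval (blockVector U) (∏ i ∈ U, X i) = 1 := by
  rw [map_prod, Finset.prod_eq_one]
  intro i hi
  simp [blockVector, hi]

/-- The squarefree monomial of a set that lies in no block vanishes on the blocks. -/
theorem prod_X_mem_blockIdeal {V : Type*} [DecidableEq V] {blocks : Finset (Finset V)}
    {U : Finset V} (hU : ∀ B ∈ blocks, ¬ U ⊆ B) :
    (∏ i ∈ U, X i : MvPolynomial V ℂ) ∈ blockIdeal blocks := by
  refine mem_blockIdeal.mpr fun B hB => ?_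
  obtain ⟨i, hi, hiB⟩ := Finset.not_subset.mp (hU B hB)
  rw [map_prod]
  exact Finset.prod_eq_zero hi (by simp [blockVector, hiB])

theorem not_subset_of_notMem {V : Type*} {blocks : Finset (Finset V)} {k : ℕ}
    (hcard : ∀ B ∈ blocks, B.card = k) {U : Finset V} (hk : U.card = k) (hU : U ∉ blocks) :
    ∀ B ∈ blocks, ¬ U ⊆ B := fun B hB h =>
  hU (Finset.eq_of_subset_of_card_le h (by rw [hk, hcard B hB]) ▸ hB)

/-- The block ideal is generated in degree at most three: modulo its cubics, `1` is the sum of the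
indicators of all point sets, and each indicator is killed unless its set is a block. -/
theorem span_cubics_eq_blockIdeal {V : Type*} [Fintype V] [DecidableEq V]
    {blocks : Finset (Finset V)} (hcard : ∀ B ∈ blocks, B.card = 3) :
    Ideal.span {f | f ∈ blockIdeal blocks ∧ f.totalDegree ≤ 3} = blockIdeal blocks := by
  refine le_antisymm (Ideal.span_le.mpr fun f hf => hf.1) ?_
  set J := Ideal.span {f | f ∈ blockIdeal blocks ∧ f.totalDegree ≤ 3}
  let e : Finset V → MvPolynomial V ℂ := fun U =>
    (∏ i ∈ U, X i) * ∏ i ∈ Finset.univ \ U, (1 - X i)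
  have idem : ∀ i : V, (X i * X i - X i : MvPolynomial V ℂ) ∈ J := by
    intro i
    refine Ideal.subset_span ⟨mem_blockIdeal.mpr fun B _ => ?_, ?_⟩
    · simp only [blockVector, map_sub, map_mul, eval_X]
      split_ifs <;> ring
    · refine (totalDegree_sub _ _).trans (max_le ((totalDegree_mul _ _).trans ?_) ?_) <;>
        simp [totalDegree_X]
  have absorb_X : ∀ (U : Finset V) (i : V), X i * e U - C (blockVector U i) * e U ∈ J := by
    intro U i
    by_cases hi : i ∈ U
    · have : X i * e U - C (blockVector U i) * e U =
          (∏ j ∈ U.erase i, X j) * (∏ j ∈ Finset.univ \ U, (1 - X j)) * (X i * X i - X i) := by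
        simp only [e, blockVector, hi, if_true, map_one, ← Finset.mul_prod_erase U _ hi]
        ring
      rw [this]
      exact J.mul_mem_left _ (idem i)
    · have hi' : i ∈ Finset.univ \ U := by simp [hi]
      have : X i * e U - C (blockVector U i) * e U =
          -((∏ j ∈ U, X j) * (∏ j ∈ (Finset.univ \ U).erase i, (1 - X j))) *
            (X i * X i - X i) := by
        simp only [e, blockVector, hi, if_false, map_zero, ← Finset.mul_prod_erase _ _ hi']
        ring
      rw [this]
      exact J.mul_mem_left _ (idem i)
  -- Modulo `J`, each `e U` is a simultaneous eigenvector: multiplication by `f` acts on it as the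
  -- value of `f` at `U`.
  have absorb : ∀ (U : Finset V) (f : MvPolynomial V ℂ),
      f * e U - C (eval (blockVector U) f) * e U ∈ J := by
    intro U f
    induction f using MvPolynomial.induction_on with
    | C r => simp
    | add p q hp hq =>
      convert J.add_mem hp hq using 1
      simp only [map_add]
      ring
    | mul_X p i hp =>
      convert J.add_mem (J.mul_mem_left (X i) hp)
        (J.mul_mem_left (C (eval (blockVector U) p)) (absorb_X U i)) using 1
      simp only [map_mul, eval_X]
      ring
  have e_mem : ∀ U : Finset V, U ∉ blocks → e U ∈ J := by
    intro U hU
    -- An element of `J` with nonzero value at `U` acts on `e U` both as zero and as an invertible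
    -- scalar, so `e U` is zero modulo `J`.
    suffices ∃ g ∈ J, eval (blockVector U) g ≠ 0 by
      obtain ⟨g, hg, hne⟩ := this
      have h1 : C (eval (blockVector U) g) * e U ∈ J := by
        convert J.sub_mem (J.mul_mem_right (e U) hg) (absorb U g) using 1
        ring
      convert J.mul_mem_left (C (eval (blockVector U) g)⁻¹) h1 using 1
      rw [← mul_assoc, ← C_mul, inv_mul_cancel₀ hne, C_1, one_mul]
    have eval_sum : ∀ W : Finset V,
        eval (blockVector W) (∑ i, X i - C 3 : MvPolynomial V ℂ) = W.card - 3 := by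
      intro W
      simp [blockVector]
    -- A non-block of size three is separated from the blocks by its own cubic monomial, any other
    -- size by the linear form `∑ X i - 3`.
    by_cases hc : U.card = 3
    · refine ⟨∏ i ∈ U, X i, Ideal.subset_span
        ⟨prod_X_mem_blockIdeal (not_subset_of_notMem hcard hc hU), ?_⟩, ?_⟩
      · refine (totalDegree_finsetProd _ _).trans ?_
        simp [totalDegree_X, hc]
      · rw [eval_prod_X_self]
        exact one_ne_zero
    · refine ⟨∑ i, X i - C 3, Ideal.subset_span ⟨mem_blockIdeal.mpr fun B hB => ?_, ?_⟩, ?_⟩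
      · rw [eval_sum, hcard B hB]
        norm_num
      · refine (totalDegree_sub _ _).trans (max_le ?_ ?_)
        · refine totalDegree_finsetSum_le fun i _ => ?_
          simp [totalDegree_X]
        · simp
      · rw [eval_sum, sub_ne_zero]
        exact_mod_cast hc
  intro f hf
  -- This expands the product of `X i + (1 - X i)` over all points.
  have one_eq : ∑ U ∈ Finset.univ.powerset, e U = 1 := by
    rw [← Finset.prod_add]
    simp
  rw [← mul_one f, ← one_eq, Finset.mul_sum]
  refine J.sum_mem fun U _ => ?_
  by_cases hU : U ∈ blocks
  · have := absorb U f
    rwa [mem_blockIdeal.mp hf U hU, C_0, zero_mul, sub_zero] at this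
  · exact J.mul_mem_left _ (e_mem U hU)

/-- If a triple system contains all faces of an octahedron but one, its ideal is generated in
degree three and not lower. -/
theorem gammaTwo_eq_three {V : Type*} [Fintype V] [DecidableEq V]
    {blocks : Finset (Finset V)} (hcard : ∀ B ∈ blocks, B.card = 3) {a b c x y z : V}
    (h : [a, b, c, x, y, z].Nodup) (h1 : {a, b, c} ∈ blocks) (h2 : {a, y, z} ∈ blocks)
    (h3 : {b, x, z} ∈ blocks) (h4 : {c, x, y} ∈ blocks) (h5 : {b, c, x} ∈ blocks)
    (h6 : {a, c, y} ∈ blocks) (h7 : {a, b, z} ∈ blocks) (h8 : {x, y, z} ∉ blocks) :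
    gammaTwo blocks = 3 := by
  refine IsLeast.csInf_eq ⟨⟨_, span_cubics_eq_blockIdeal hcard, fun f hf => hf.2⟩, ?_⟩
  rintro s ⟨G, hG, hdeg⟩
  by_contra! hs
  -- Generators of degree at most two vanish at the eighth face, hence so would the whole ideal; the
  -- monomial of that face contradicts this.
  have hle : blockIdeal blocks ≤ RingHom.ker (eval (blockVector {x, y, z})) := by
    rw [← hG, Ideal.span_le]
    intro f hf
    have hfI := mem_blockIdeal.mp (hG ▸ Ideal.subset_span hf)
    rw [SetLike.mem_coe, RingHom.mem_ker, eval_octahedron h ((hdeg f hf).trans (by omega)),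
      hfI _ h1, hfI _ h2, hfI _ h3, hfI _ h4, hfI _ h5, hfI _ h6, hfI _ h7]
    ring
  have hcard3 : ({x, y, z} : Finset V).card = 3 := by
    simp only [List.nodup_cons, List.mem_cons, List.not_mem_nil, or_false, not_or] at h
    exact Finset.card_eq_three.mpr ⟨x, y, z, by tauto, by tauto, by tauto, rfl⟩
  have := RingHom.mem_ker.mp
    (hle (prod_X_mem_blockIdeal (not_subset_of_notMem hcard hcard3 h8)))
  rw [eval_prod_X_self] at this
  exact one_ne_zero this

end PolynomialIdeal

/-! ### Twofold triple systems as ternary relations -/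

/-- `R x y z` is the relation "`{x, y, z}` is a block" of a triple system in which every pair of
points lies in exactly two blocks, and no block is repeated. -/
structure IsTwofold {V : Type*} (R : V → V → V → Prop) : Prop where
  ne : ∀ {x y z}, R x y z → x ≠ y
  swap_left : ∀ {x y z}, R x y z → R y x z
  swap_right : ∀ {x y z}, R x y z → R x z y
  two : ∀ {x y}, x ≠ y → ∃ p q, p ≠ q ∧ ∀ z, R x y z ↔ z = p ∨ z = q

/-- Seven faces of an octahedron are blocks and the eighth is not. -/
def HasPuncturedOctahedron {V : Type*} (R : V → V → V → Prop) : Prop :=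
  ∃ a b c x y z : V, [a, b, c, x, y, z].Nodup ∧ R a b c ∧ R a y z ∧ R b x z ∧ R c x y ∧
    R b c x ∧ R a c y ∧ R a b z ∧ ¬ R x y z

open Classical in
/-- The blocks of a ternary relation. -/
noncomputable def tripleBlocks {V : Type*} [Fintype V] (R : V → V → V → Prop) :
    Finset (Finset V) :=
  Finset.univ.filter fun B => ∃ x y z, R x y z ∧ (B : Set V) = {x, y, z}

namespace IsTwofold

theorem ne₃ {V : Type*} {R : V → V → V → Prop} (hR : IsTwofold R) {x y z : V}
    (h : R x y z) : x ≠ y ∧ x ≠ z ∧ y ≠ z :=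
  ⟨hR.ne h, hR.ne (hR.swap_right h), hR.ne (hR.swap_right (hR.swap_left h))⟩

variable {V : Type*} [Fintype V] [DecidableEq V] {R : V → V → V → Prop}

theorem mem_tripleBlocks {B : Finset V} :
    B ∈ tripleBlocks R ↔ ∃ x y z, R x y z ∧ B = {x, y, z} := by
  simp only [tripleBlocks, Finset.mem_filter, Finset.mem_univ, true_and]
  refine exists₃_congr fun x y z => and_congr_right fun _ => ?_
  rw [← Finset.coe_inj]
  simp

theorem exists_third (hR : IsTwofold R) {B : Finset V} (hB : B ∈ tripleBlocks R) {x y : V}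
    (hx : x ∈ B) (hy : y ∈ B) (hxy : x ≠ y) : ∃ z, R x y z ∧ B = {x, y, z} := by
  obtain ⟨a, b, c, h, rfl⟩ := mem_tripleBlocks.mp hB
  have h1 := hR.swap_left h
  have h2 := hR.swap_right h
  have h3 := hR.swap_left h2
  have h4 := hR.swap_right h1
  have h5 := hR.swap_left h4
  simp only [Finset.mem_insert, Finset.mem_singleton] at hx hy
  rcases hx with rfl | rfl | rfl <;> rcases hy with rfl | rfl | rfl <;>
    first
    | exact absurd rfl hxy
    | exact ⟨_, h, rfl⟩
    | exact ⟨_, h1, by ext; simp only [Finset.mem_insert, Finset.mem_singleton]; tauto⟩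
    | exact ⟨_, h2, by ext; simp only [Finset.mem_insert, Finset.mem_singleton]; tauto⟩
    | exact ⟨_, h3, by ext; simp only [Finset.mem_insert, Finset.mem_singleton]; tauto⟩
    | exact ⟨_, h4, by ext; simp only [Finset.mem_insert, Finset.mem_singleton]; tauto⟩
    | exact ⟨_, h5, by ext; simp only [Finset.mem_insert, Finset.mem_singleton]; tauto⟩

theorem mem_iff (hR : IsTwofold R) {x y z : V} (hxy : x ≠ y) (hxz : x ≠ z) (hyz : y ≠ z) :
    {x, y, z} ∈ tripleBlocks R ↔ R x y z := by
  refine ⟨fun h => ?_, fun h => mem_tripleBlocks.mpr ⟨x, y, z, h, rfl⟩⟩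
  obtain ⟨t, ht, he⟩ := hR.exists_third h (by simp) (by simp) hxy
  have : z ∈ ({x, y, t} : Finset V) := he ▸ by simp
  simp only [Finset.mem_insert, Finset.mem_singleton] at this
  rcases this with rfl | rfl | rfl
  · exact absurd rfl hxz
  · exact absurd rfl hyz
  · exact ht

theorem card_eq_three (hR : IsTwofold R) : ∀ B ∈ tripleBlocks R, B.card = 3 := by
  intro B hB
  obtain ⟨x, y, z, h, rfl⟩ := mem_tripleBlocks.mp hB
  obtain ⟨h1, h2, h3⟩ := hR.ne₃ h
  exact Finset.card_eq_three.mpr ⟨x, y, z, h1, h2, h3, rfl⟩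

theorem isBlockDesign (hR : IsTwofold R) :
    IsBlockDesign 2 (Fintype.card V) 3 2 (tripleBlocks R) := by
  refine ⟨rfl, hR.card_eq_three, fun T hT => ?_⟩
  obtain ⟨x, y, hxy, rfl⟩ := Finset.card_eq_two.mp hT
  obtain ⟨p, q, hpq, h⟩ := hR.two hxy
  have hp := (h p).mpr (Or.inl rfl)
  have hq := (h q).mpr (Or.inr rfl)
  refine Finset.card_eq_two.mpr ⟨{x, y, p}, {x, y, q}, fun he => ?_, ?_⟩
  · have : p ∈ ({x, y, q} : Finset V) := he ▸ by simp
    simp only [Finset.mem_insert, Finset.mem_singleton] at this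
    have hne := hR.ne₃ hp
    tauto
  · ext B
    simp only [Finset.mem_filter, Finset.mem_insert, Finset.mem_singleton]
    constructor
    · rintro ⟨hB, hsub⟩
      obtain ⟨z, hz, rfl⟩ := hR.exists_third hB (hsub (by simp)) (hsub (by simp)) hxy
      rcases (h z).mp hz with rfl | rfl <;> simp
    · rintro (rfl | rfl)
      · exact ⟨mem_tripleBlocks.mpr ⟨_, _, _, hp, rfl⟩, by intro; simp; tauto⟩
      · exact ⟨mem_tripleBlocks.mpr ⟨_, _, _, hq, rfl⟩, by intro; simp; tauto⟩

theorem gammaTwo_tripleBlocks (hR : IsTwofold R) (h : HasPuncturedOctahedron R) :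
    gammaTwo (tripleBlocks R) = 3 := by
  obtain ⟨a, b, c, x, y, z, hnd, h1, h2, h3, h4, h5, h6, h7, h8⟩ := h
  have mem : ∀ {p q r}, R p q r → {p, q, r} ∈ tripleBlocks R := fun h =>
    mem_tripleBlocks.mpr ⟨_, _, _, h, rfl⟩
  refine gammaTwo_eq_three hR.card_eq_three hnd (mem h1) (mem h2) (mem h3) (mem h4) (mem h5)
    (mem h6) (mem h7) ?_
  simp only [List.nodup_cons, List.mem_cons, List.not_mem_nil, or_false, not_or] at hnd
  rwa [hR.mem_iff (by tauto) (by tauto) (by tauto)]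

end IsTwofold

/-- There is a twofold triple system on `v` points with a punctured octahedron. -/
def PuncturedOrder (v : ℕ) : Prop :=
  ∃ R : Fin v → Fin v → Fin v → Prop, IsTwofold R ∧ HasPuncturedOctahedron R

/-- An equivalence is required of `f`, not only an implication, because the missing face must stay
missing. -/
theorem HasPuncturedOctahedron.of_embedding {V W : Type*} {R : V → V → V → Prop}
    {R' : W → W → W → Prop} (h : HasPuncturedOctahedron R) {f : V → W} (hf : f.Injective)
    (hR : ∀ x y z, R' (f x) (f y) (f z) ↔ R x y z) : HasPuncturedOctahedron R' := by
  obtain ⟨a, b, c, x, y, z, hnd, h⟩ := h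
  refine ⟨f a, f b, f c, f x, f y, f z, hnd.map hf, ?_⟩
  simpa only [hR] using h

theorem PuncturedOrder.of_card {V : Type*} [Fintype V] {R : V → V → V → Prop} {v : ℕ}
    (hR : IsTwofold R) (h : HasPuncturedOctahedron R) (hv : Fintype.card V = v) :
    PuncturedOrder v := by
  let e : V ≃ Fin v := Fintype.equivFinOfCardEq hv
  refine ⟨fun x y z => R (e.symm x) (e.symm y) (e.symm z), ⟨?_, ?_, ?_, ?_⟩,
    h.of_embedding e.injective (by simp)⟩
  · exact fun h he => hR.ne h (he ▸ rfl)
  · exact fun h => hR.swap_left h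
  · exact fun h => hR.swap_right h
  · intro x y hxy
    obtain ⟨p, q, hpq, h⟩ := hR.two (e.symm.injective.ne hxy)
    exact ⟨e p, e q, e.injective.ne hpq, fun z => by simp only [h, e.symm_apply_eq]⟩

/-! ### Gluing a system to 2-regular graphs -/

/-- Extend a triple system on `Y` to `Y ⊕ Z` by triples inside `Z` and by graphs on `Z`, one for
each point of `Y`. -/
def extendRel {Y Z : Type*} (R : Y → Y → Y → Prop) (S : Z → Z → Z → Prop) (F : Y → Z → Z → Prop) :
    Y ⊕ Z → Y ⊕ Z → Y ⊕ Z → Prop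
  | .inl a, .inl b, .inl c => R a b c
  | .inl a, .inr y, .inr z => F a y z
  | .inr x, .inl b, .inr z => F b x z
  | .inr x, .inr y, .inl c => F c x y
  | .inr x, .inr y, .inr z => S x y z
  | _, _, _ => False

/-- A mixed pair `a, x` gets its third points from the two neighbours of `x` in the graph of `a`. A
pair inside `Z` must be served entirely by `S` or entirely by the graphs, which is `cover`. -/
theorem IsTwofold.extend {Y Z : Type*} {R : Y → Y → Y → Prop} (hR : IsTwofold R)
    {S : Z → Z → Z → Prop} {F : Y → Z → Z → Prop}
    (S_ne : ∀ {x y z}, S x y z → x ≠ y) (S_left : ∀ {x y z}, S x y z → S y x z)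
    (S_right : ∀ {x y z}, S x y z → S x z y)
    (F_ne : ∀ {a x y}, F a x y → x ≠ y) (F_symm : ∀ {a x y}, F a x y → F a y x)
    (F_two : ∀ a x, ∃ p q, p ≠ q ∧ ∀ y, F a x y ↔ y = p ∨ y = q)
    (cover : ∀ x y, x ≠ y →
      (∃ p q, p ≠ q ∧ (∀ z, S x y z ↔ z = p ∨ z = q) ∧ ∀ a, ¬ F a x y) ∨
      (∃ p q, p ≠ q ∧ (∀ a, F a x y ↔ a = p ∨ a = q) ∧ ∀ z, ¬ S x y z)) :
    IsTwofold (extendRel R S F) := by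
  refine ⟨?_, ?_, ?_, ?_⟩
  · rintro (x | x) (y | y) (z | z) h he <;> simp only [extendRel, reduceCtorEq] at h he
    · exact hR.ne h (Sum.inl.inj he)
    · exact F_ne h (Sum.inr.inj he)
    · exact S_ne h (Sum.inr.inj he)
  · rintro (x | x) (y | y) (z | z) h <;> simp only [extendRel] at h ⊢
    · exact hR.swap_left h
    · exact h
    · exact h
    · exact F_symm h
    · exact S_left h
  · rintro (x | x) (y | y) (z | z) h <;> simp only [extendRel] at h ⊢
    · exact hR.swap_right h
    · exact F_symm h
    · exact h
    · exact h
    · exact S_right h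
  · rintro (x | x) (y | y) hxy
    · obtain ⟨p, q, hpq, h⟩ := hR.two (fun he => hxy (congrArg _ he))
      exact ⟨.inl p, .inl q, by simpa using hpq, by rintro (z | z) <;> simp [extendRel, h]⟩
    · obtain ⟨p, q, hpq, h⟩ := F_two x y
      exact ⟨.inr p, .inr q, by simpa using hpq, by rintro (z | z) <;> simp [extendRel, h]⟩
    · obtain ⟨p, q, hpq, h⟩ := F_two y x
      exact ⟨.inr p, .inr q, by simpa using hpq, by rintro (z | z) <;> simp [extendRel, h]⟩
    · rcases cover x y (fun he => hxy (congrArg _ he)) with ⟨p, q, hpq, h, h'⟩ | ⟨p, q, hpq, h, h'⟩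
      · exact ⟨.inr p, .inr q, by simpa using hpq, by rintro (z | z) <;> simp [extendRel, h, h']⟩
      · exact ⟨.inl p, .inl q, by simpa using hpq, by rintro (z | z) <;> simp [extendRel, h, h']⟩

/-! ### Graphs of differences -/

/-- In an abelian group with one involution `h`, the graph of the differences `±d`, except that
the perfect matching of differences `h`, which would occur twice, is recombined with the two
perfect matchings `{x, x + ε x}` and `{x, x - ε x}` into which the differences `±o` split. -/
def differenceGraph {Z : Type*} [AddCommGroup Z] (h o : Z) (ε : Z → Z) (d x y : Z) : Prop :=
  (d ≠ h ∧ d ≠ -o ∧ (y = x + d ∨ y = x - d)) ∨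
  (d = -o ∧ (y = x + h ∨ y = x + ε x)) ∨ (d = h ∧ (y = x + h ∨ y = x - ε x))

section DifferenceGraph

variable {Z : Type*} [AddCommGroup Z] {h o : Z} {ε : Z → Z}

theorem differenceGraph_ne (hh : h ≠ 0) (ho : o ≠ 0) (hε : ∀ x, ε x = o ∨ ε x = -o) {d x y : Z}
    (hd : d ≠ 0) (hF : differenceGraph h o ε d x y) : x ≠ y := by
  have hε0 : ε x ≠ 0 := by rcases hε x with he | he <;> simpa [he] using ho
  rintro rfl
  rcases hF with ⟨-, -, h1 | h1⟩ | ⟨-, h1 | h1⟩ | ⟨-, h1 | h1⟩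
  · exact hd (left_eq_add.mp h1)
  · exact hd (sub_eq_self.mp h1.symm)
  · exact hh (left_eq_add.mp h1)
  · exact hε0 (left_eq_add.mp h1)
  · exact hh (left_eq_add.mp h1)
  · exact hε0 (sub_eq_self.mp h1.symm)

/-- Moving by `±o` flips the sign of `ε`, so the step `ε x` from `x` is undone by the step `ε` at
the other end; the step `h` is its own inverse. -/
theorem differenceGraph_symm (hh2 : h + h = 0) (hε : ∀ x, ε x = o ∨ ε x = -o)
    (hadd : ∀ x, ε (x + o) = -ε x) (hsub : ∀ x, ε (x - o) = -ε x) {d x y : Z}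
    (hF : differenceGraph h o ε d x y) : differenceGraph h o ε d y x := by
  have hneg : -h = h := (eq_neg_of_add_eq_zero_left hh2).symm
  have h1 : ∀ x, ε (x + ε x) = -ε x := by
    intro x; rcases hε x with he | he <;> simp only [he, ← sub_eq_add_neg]
    · rw [hadd, he]
    · rw [hsub, he]
  have h2 : ∀ x, ε (x - ε x) = -ε x := by
    intro x; rcases hε x with he | he <;> simp only [he, sub_neg_eq_add]
    · rw [hsub, he]
    · rw [hadd, he]
  have h3 : ∀ x, x = x + h + h := fun x => by rw [add_assoc, hh2, add_zero]
  rcases hF with ⟨d1, d2, rfl | rfl⟩ | ⟨rfl, rfl | rfl⟩ | ⟨rfl, rfl | rfl⟩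
  · exact .inl ⟨d1, d2, .inr (by abel)⟩
  · exact .inl ⟨d1, d2, .inl (by abel)⟩
  · exact .inr (.inl ⟨rfl, .inl (h3 x)⟩)
  · exact .inr (.inl ⟨rfl, .inr (by rw [h1]; abel)⟩)
  · exact .inr (.inr ⟨rfl, .inl (h3 x)⟩)
  · exact .inr (.inr ⟨rfl, .inr (by rw [h2]; abel)⟩)

theorem differenceGraph_two (hh2 : ∀ d, d + d = 0 → d = 0 ∨ d = h) (hho : h ≠ o) (hho' : h ≠ -o)
    (hε : ∀ x, ε x = o ∨ ε x = -o) {d : Z} (hd : d ≠ 0) (x : Z) :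
    ∃ p q, p ≠ q ∧ ∀ y, differenceGraph h o ε d x y ↔ y = p ∨ y = q := by
  have hεh : h ≠ ε x := by rcases hε x with he | he <;> rwa [he]
  have hεh' : h ≠ -ε x := by rcases hε x with he | he <;> simpa [he]
  by_cases d1 : d = h
  · subst d1
    exact ⟨x + d, x - ε x, by simpa [sub_eq_add_neg] using hεh', fun y => by
      simp [differenceGraph, hho']⟩
  by_cases d2 : d = -o
  · subst d2
    exact ⟨x + h, x + ε x, by simpa using hεh, fun y => by
      simp [differenceGraph, d1]⟩
  · refine ⟨x + d, x - d, fun he => ?_, fun y => by simp [differenceGraph, d1, d2]⟩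
    rw [sub_eq_add_neg, add_right_inj, eq_neg_iff_add_eq_zero] at he
    exact (hh2 d he).elim hd d1

theorem differenceGraph_iff {d x y : Z} : differenceGraph h o ε d x y ↔
    (d ≠ h ∧ d ≠ -o ∧ (d = y - x ∨ d = -(y - x))) ∨ (d = -o ∧ (y - x = h ∨ y - x = ε x)) ∨
      (d = h ∧ (y - x = h ∨ y - x = -ε x)) := by
  have h1 : ∀ e, y = x + e ↔ y - x = e := fun e => by rw [sub_eq_iff_eq_add']
  have h2 : ∀ e, y = x - e ↔ y - x = -e := fun e => by rw [sub_eq_add_neg, h1]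
  simp only [differenceGraph, h1, h2, eq_comm (a := d) (b := y - x), eq_neg_iff_add_eq_zero,
    add_comm d]

theorem not_differenceGraph_of_mem {A : Set Z} (hneg : ∀ d ∈ A, -d ∈ A) (hoA : o ∉ A)
    (hhA : h ∉ A) (hε : ∀ x, ε x = o ∨ ε x = -o) {d x y : Z} (hd : d ∉ A) (hxy : y - x ∈ A) :
    ¬ differenceGraph h o ε d x y := by
  have hoA' : -o ∉ A := fun h => hoA (neg_neg o ▸ hneg _ h)
  have hεA : ε x ∉ A ∧ -ε x ∉ A := by rcases hε x with he | he <;> simp [he, hoA, hoA']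
  rw [differenceGraph_iff]
  rintro (⟨-, -, rfl | rfl⟩ | ⟨-, h1 | h1⟩ | ⟨-, h1 | h1⟩)
  · exact hd hxy
  · exact hd (hneg _ hxy)
  all_goals simp_all

/-- An ordinary difference `e` occurs for the labels `e` and `-e`, and `h` for `h` and `-o`. An edge
of difference `±o` occurs for the label `o` and for whichever of `-o`, `h` received its matching. -/
theorem differenceGraph_cover {A : Set Z} (hneg : ∀ d ∈ A, -d ∈ A) (h0 : (0 : Z) ∈ A)
    (hoA : o ∉ A) (hhA : h ∉ A) (hh : h + h = 0) (hh2 : ∀ d, d + d = 0 → d = 0 ∨ d = h)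
    (hho : h ≠ o) (hho' : h ≠ -o) (hε : ∀ x, ε x = o ∨ ε x = -o) {x y : Z} (hxy : y - x ∉ A) :
    ∃ p q : {d // d ∉ A}, p ≠ q ∧ ∀ d : {d // d ∉ A},
      differenceGraph h o ε d x y ↔ d = p ∨ d = q := by
  have hoA' : -o ∉ A := fun h => hoA (neg_neg o ▸ hneg _ h)
  have hne : ∀ d, d ∉ A → d ≠ h → d ≠ -d := fun d hd hdh he =>
    (hh2 d (eq_neg_iff_add_eq_zero.mp he)).elim (fun h => hd (h ▸ h0)) hdh
  have hhn : h = -h := eq_neg_iff_add_eq_zero.mpr hh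
  have hoo : o ≠ -o := hne o hoA hho.symm
  have hxy' : -(y - x) ∉ A := fun h => hxy (neg_neg (y - x) ▸ hneg _ h)
  simp only [differenceGraph_iff, Subtype.ext_iff, Subtype.exists, Subtype.forall, ne_eq,
    exists_prop]
  generalize y - x = e at *
  have hen := hne e hxy
  have hnn : - -o = o := neg_neg o
  by_cases e1 : e = h
  · exact ⟨h, hhA, -o, hoA', hho', by grind⟩
  by_cases e2 : e = ε x
  · exact ⟨o, hoA, -o, hoA', hoo, by rcases hε x with he | he <;> grind⟩
  by_cases e3 : e = -ε x
  · exact ⟨o, hoA, h, hhA, hho.symm, by rcases hε x with he | he <;> grind⟩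
  · exact ⟨e, hxy, -e, hxy', hen e1, by rcases hε x with he | he <;> grind⟩

end DifferenceGraph

/-! ### Explicit systems checked by computation -/

/-- All orderings of a list of triples. -/
def orderings (L : List (ℕ × ℕ × ℕ)) : List (ℕ × ℕ × ℕ) :=
  L.flatMap fun (a, b, c) => [(a, b, c), (a, c, b), (b, a, c), (b, c, a), (c, a, b), (c, b, a)]

/-- The pairs that form a block with `x`. -/
def linkOf (L : List (ℕ × ℕ × ℕ)) (x : ℕ) : List (ℕ × ℕ) :=
  (orderings L).filterMap fun t => if t.1 = x then some t.2 else none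

/-- The third points of the blocks through `y` in a link. -/
def thirdPoints (l : List (ℕ × ℕ)) (y : ℕ) : List ℕ :=
  l.filterMap fun t => if t.1 = y then some t.2 else none

/-- Two different entries below `v`, and no others. -/
def isPairBelow (v : ℕ) : List ℕ → Bool
  | [p, q] => p != q && p < v && q < v
  | _ => false

/-- Every pair of points below `v` has exactly two third points. -/
def coversTwice (v : ℕ) (L : List (ℕ × ℕ × ℕ)) : Bool :=
  (List.range v).all fun x =>
    let l := linkOf L x
    (List.range v).all fun y => if x = y then (thirdPoints l y).isEmpty else
      isPairBelow v (thirdPoints l y)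

theorem mem_orderings {L : List (ℕ × ℕ × ℕ)} {x y z : ℕ} :
    (x, y, z) ∈ orderings L ↔ (x, y, z) ∈ L ∨ (x, z, y) ∈ L ∨ (y, x, z) ∈ L ∨ (y, z, x) ∈ L ∨
      (z, x, y) ∈ L ∨ (z, y, x) ∈ L := by
  simp only [orderings, List.mem_flatMap, Prod.exists, List.mem_cons, Prod.mk.injEq,
    List.not_mem_nil, or_false]
  constructor
  · rintro ⟨a, b, c, h, ⟨rfl, rfl, rfl⟩ | ⟨rfl, rfl, rfl⟩ | ⟨rfl, rfl, rfl⟩ | ⟨rfl, rfl, rfl⟩ |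
      ⟨rfl, rfl, rfl⟩ | ⟨rfl, rfl, rfl⟩⟩ <;> tauto
  · rintro (h | h | h | h | h | h) <;> exact ⟨_, _, _, h, by tauto⟩

theorem mem_thirdPoints {L : List (ℕ × ℕ × ℕ)} {x y z : ℕ} :
    z ∈ thirdPoints (linkOf L x) y ↔ (x, y, z) ∈ orderings L := by
  simp [thirdPoints, linkOf]

/-- A list of triples that covers every pair twice and contains the standard punctured
octahedron. -/
theorem PuncturedOrder.of_list {v : ℕ} (L : List (ℕ × ℕ × ℕ)) (hv : 6 ≤ v)
    (hL : coversTwice v L = true)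
    (hmem : [(0, 1, 2), (0, 4, 5), (1, 3, 5), (2, 3, 4), (1, 2, 3), (0, 2, 4), (0, 1, 5)] ⊆
      orderings L)
    (hnot : (3, 4, 5) ∉ orderings L) : PuncturedOrder v := by
  simp only [coversTwice, List.all_eq_true, List.mem_range] at hL
  refine ⟨fun x y z => (x.1, y.1, z.1) ∈ orderings L, ⟨?_, ?_, ?_, ?_⟩, ?_⟩
  -- The diagonal test in `coversTwice` excludes triples with a repeated point.
  · rintro x y z h rfl
    have := hL x x.2 x x.2
    rw [if_pos rfl, List.isEmpty_iff] at this
    rw [← mem_thirdPoints, this] at h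
    exact List.not_mem_nil h
  · intro x y z
    simp only [mem_orderings]
    tauto
  · intro x y z
    simp only [mem_orderings]
    tauto
  · intro x y hxy
    have := hL x x.2 y y.2
    rw [if_neg (Fin.val_ne_of_ne hxy)] at this
    simp only [← mem_thirdPoints]
    match hl : thirdPoints (linkOf L x) y, this with
    | [p, q], h =>
      simp only [isPairBelow, Bool.and_eq_true, bne_iff_ne, decide_eq_true_eq] at h
      exact ⟨⟨p, h.1.2⟩, ⟨q, h.2⟩, by simpa using h.1.1, fun z => by simp [Fin.ext_iff]⟩
  -- The antipodal pairs are `0, 3`, `1, 4` and `2, 5`.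
  · refine ⟨⟨0, by omega⟩, ⟨1, by omega⟩, ⟨2, by omega⟩, ⟨3, by omega⟩, ⟨4, by omega⟩,
      ⟨5, by omega⟩, by simp, ?_⟩
    simp only [List.cons_subset] at hmem
    tauto

/-- Order 13 lies below the range of the theorem but is needed to reach 27 and 33. -/
theorem puncturedOrder_13 : PuncturedOrder 13 :=
  .of_list
    [(0, 1, 2), (0, 1, 5), (0, 2, 4), (0, 3, 10), (0, 3, 11), (0, 4, 5), (0, 6, 8), (0, 6, 12),
    (0, 7, 9), (0, 7, 12), (0, 8, 9), (0, 10, 11), (1, 2, 3), (1, 3, 5), (1, 4, 6), (1, 4, 9),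
    (1, 6, 12), (1, 7, 8), (1, 7, 9), (1, 8, 10), (1, 10, 11), (1, 11, 12), (2, 3, 4), (2, 5, 9),
    (2, 5, 12), (2, 6, 7), (2, 6, 11), (2, 7, 8), (2, 8, 10), (2, 9, 11), (2, 10, 12), (3, 4, 12),
    (3, 5, 7), (3, 6, 7), (3, 6, 9), (3, 8, 11), (3, 8, 12), (3, 9, 10), (4, 5, 8), (4, 6, 10),
    (4, 7, 10), (4, 7, 11), (4, 8, 11), (4, 9, 12), (5, 6, 10), (5, 6, 11), (5, 7, 11), (5, 8, 12),
    (5, 9, 10), (6, 8, 9), (7, 10, 12), (9, 11, 12)]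
    (by decide) (by decide +kernel) (by decide +kernel) (by decide +kernel)

theorem puncturedOrder_15 : PuncturedOrder 15 :=
  .of_list
    [(0, 1, 2), (0, 1, 5), (0, 2, 4), (0, 3, 12), (0, 3, 13), (0, 4, 5), (0, 6, 10), (0, 6, 12),
    (0, 7, 8), (0, 7, 9), (0, 8, 14), (0, 9, 11), (0, 10, 11), (0, 13, 14), (1, 2, 3), (1, 3, 5),
    (1, 4, 8), (1, 4, 12), (1, 6, 8), (1, 6, 13), (1, 7, 9), (1, 7, 11), (1, 9, 14), (1, 10, 12),
    (1, 10, 14), (1, 11, 13), (2, 3, 4), (2, 5, 7), (2, 5, 8), (2, 6, 11), (2, 6, 14), (2, 7, 14),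
    (2, 8, 9), (2, 9, 13), (2, 10, 11), (2, 10, 12), (2, 12, 13), (3, 4, 6), (3, 5, 10),
    (3, 6, 14), (3, 7, 8), (3, 7, 11), (3, 8, 9), (3, 9, 12), (3, 10, 13), (3, 11, 14), (4, 5, 11),
    (4, 6, 13), (4, 7, 10), (4, 7, 13), (4, 8, 10), (4, 9, 12), (4, 9, 14), (4, 11, 14), (5, 6, 7),
    (5, 6, 9), (5, 8, 13), (5, 9, 10), (5, 11, 12), (5, 12, 14), (5, 13, 14), (6, 7, 10),
    (6, 8, 12), (6, 9, 11), (7, 12, 13), (7, 12, 14), (8, 10, 14), (8, 11, 12), (8, 11, 13),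
    (9, 10, 13)]
    (by decide) (by decide +kernel) (by decide +kernel) (by decide +kernel)

theorem puncturedOrder_19 : PuncturedOrder 19 :=
  .of_list
    [(0, 1, 2), (0, 1, 5), (0, 2, 4), (0, 3, 7), (0, 3, 12), (0, 4, 5), (0, 6, 7), (0, 6, 14),
    (0, 8, 11), (0, 8, 15), (0, 9, 10), (0, 9, 13), (0, 10, 12), (0, 11, 14), (0, 13, 16),
    (0, 15, 18), (0, 16, 17), (0, 17, 18), (1, 2, 3), (1, 3, 5), (1, 4, 13), (1, 4, 14),
    (1, 6, 17), (1, 6, 18), (1, 7, 9), (1, 7, 16), (1, 8, 12), (1, 8, 16), (1, 9, 15), (1, 10, 12),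
    (1, 10, 17), (1, 11, 13), (1, 11, 18), (1, 14, 15), (2, 3, 4), (2, 5, 11), (2, 5, 12),
    (2, 6, 7), (2, 6, 10), (2, 7, 17), (2, 8, 13), (2, 8, 14), (2, 9, 11), (2, 9, 15), (2, 10, 17),
    (2, 12, 18), (2, 13, 16), (2, 14, 16), (2, 15, 18), (3, 4, 10), (3, 5, 11), (3, 6, 9),
    (3, 6, 13), (3, 7, 13), (3, 8, 10), (3, 8, 17), (3, 9, 16), (3, 11, 14), (3, 12, 15),
    (3, 14, 18), (3, 15, 17), (3, 16, 18), (4, 5, 18), (4, 6, 11), (4, 6, 13), (4, 7, 12),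
    (4, 7, 16), (4, 8, 11), (4, 8, 16), (4, 9, 17), (4, 9, 18), (4, 10, 15), (4, 12, 17),
    (4, 14, 15), (5, 6, 8), (5, 6, 9), (5, 7, 10), (5, 7, 15), (5, 8, 17), (5, 9, 14), (5, 10, 13),
    (5, 12, 13), (5, 14, 18), (5, 15, 16), (5, 16, 17), (6, 8, 18), (6, 10, 14), (6, 11, 16),
    (6, 12, 15), (6, 12, 16), (6, 15, 17), (7, 8, 9), (7, 8, 18), (7, 10, 11), (7, 11, 15),
    (7, 12, 14), (7, 13, 18), (7, 14, 17), (8, 9, 12), (8, 10, 14), (8, 13, 15), (9, 10, 13),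
    (9, 11, 17), (9, 12, 18), (9, 14, 16), (10, 11, 18), (10, 15, 16), (10, 16, 18), (11, 12, 16),
    (11, 12, 17), (11, 13, 15), (12, 13, 14), (13, 14, 17), (13, 17, 18)]
    (by decide) (by decide +kernel) (by decide +kernel) (by decide +kernel)

theorem puncturedOrder_21 : PuncturedOrder 21 :=
  .of_list
    [(0, 1, 2), (0, 1, 5), (0, 2, 4), (0, 3, 7), (0, 3, 10), (0, 4, 5), (0, 6, 8), (0, 6, 18),
    (0, 7, 12), (0, 8, 12), (0, 9, 13), (0, 9, 16), (0, 10, 19), (0, 11, 13), (0, 11, 17),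
    (0, 14, 18), (0, 14, 20), (0, 15, 17), (0, 15, 19), (0, 16, 20), (1, 2, 3), (1, 3, 5),
    (1, 4, 13), (1, 4, 20), (1, 6, 17), (1, 6, 20), (1, 7, 12), (1, 7, 17), (1, 8, 9), (1, 8, 11),
    (1, 9, 10), (1, 10, 16), (1, 11, 14), (1, 12, 15), (1, 13, 18), (1, 14, 18), (1, 15, 19),
    (1, 16, 19), (2, 3, 4), (2, 5, 18), (2, 5, 19), (2, 6, 8), (2, 6, 10), (2, 7, 8), (2, 7, 14),
    (2, 9, 14), (2, 9, 17), (2, 10, 20), (2, 11, 13), (2, 11, 17), (2, 12, 15), (2, 12, 20),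
    (2, 13, 19), (2, 15, 16), (2, 16, 18), (3, 4, 16), (3, 5, 11), (3, 6, 18), (3, 6, 20),
    (3, 7, 8), (3, 8, 15), (3, 9, 13), (3, 9, 16), (3, 10, 11), (3, 12, 14), (3, 12, 18),
    (3, 13, 19), (3, 14, 15), (3, 17, 19), (3, 17, 20), (4, 5, 17), (4, 6, 13), (4, 6, 15),
    (4, 7, 11), (4, 7, 15), (4, 8, 14), (4, 8, 16), (4, 9, 12), (4, 9, 18), (4, 10, 12),
    (4, 10, 17), (4, 11, 19), (4, 14, 20), (4, 18, 19), (5, 6, 14), (5, 6, 16), (5, 7, 9),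
    (5, 7, 14), (5, 8, 19), (5, 8, 20), (5, 9, 17), (5, 10, 12), (5, 10, 16), (5, 11, 12),
    (5, 13, 15), (5, 13, 20), (5, 15, 18), (6, 7, 10), (6, 7, 13), (6, 9, 11), (6, 9, 15),
    (6, 11, 19), (6, 12, 16), (6, 12, 19), (6, 14, 17), (7, 9, 18), (7, 10, 15), (7, 11, 20),
    (7, 13, 17), (7, 16, 18), (7, 16, 19), (7, 19, 20), (8, 9, 19), (8, 10, 15), (8, 10, 17),
    (8, 11, 18), (8, 12, 13), (8, 13, 14), (8, 16, 17), (8, 18, 20), (9, 10, 14), (9, 11, 15),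
    (9, 12, 20), (9, 19, 20), (10, 11, 18), (10, 13, 18), (10, 13, 20), (10, 14, 19), (11, 12, 16),
    (11, 14, 15), (11, 16, 20), (12, 13, 17), (12, 14, 19), (12, 17, 18), (13, 14, 16),
    (13, 15, 16), (14, 16, 17), (15, 17, 20), (15, 18, 20), (17, 18, 19)]
    (by decide) (by decide +kernel) (by decide +kernel) (by decide +kernel)

theorem puncturedOrder_25 : PuncturedOrder 25 :=
  .of_list
    [(0, 1, 2), (0, 1, 5), (0, 2, 4), (0, 3, 6), (0, 3, 15), (0, 4, 5), (0, 6, 10), (0, 7, 11),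
    (0, 7, 24), (0, 8, 9), (0, 8, 22), (0, 9, 11), (0, 10, 17), (0, 12, 14), (0, 12, 16),
    (0, 13, 19), (0, 13, 22), (0, 14, 23), (0, 15, 19), (0, 16, 17), (0, 18, 20), (0, 18, 24),
    (0, 20, 21), (0, 21, 23), (1, 2, 3), (1, 3, 5), (1, 4, 12), (1, 4, 21), (1, 6, 14), (1, 6, 16),
    (1, 7, 15), (1, 7, 17), (1, 8, 16), (1, 8, 19), (1, 9, 12), (1, 9, 22), (1, 10, 13),
    (1, 10, 15), (1, 11, 20), (1, 11, 24), (1, 13, 19), (1, 14, 18), (1, 17, 21), (1, 18, 23),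
    (1, 20, 22), (1, 23, 24), (2, 3, 4), (2, 5, 9), (2, 5, 18), (2, 6, 13), (2, 6, 23), (2, 7, 11),
    (2, 7, 22), (2, 8, 13), (2, 8, 16), (2, 9, 21), (2, 10, 11), (2, 10, 12), (2, 12, 14),
    (2, 14, 24), (2, 15, 18), (2, 15, 20), (2, 16, 17), (2, 17, 23), (2, 19, 21), (2, 19, 24),
    (2, 20, 22), (3, 4, 19), (3, 5, 21), (3, 6, 21), (3, 7, 10), (3, 7, 14), (3, 8, 18),
    (3, 8, 22), (3, 9, 13), (3, 9, 15), (3, 10, 22), (3, 11, 16), (3, 11, 23), (3, 12, 20),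
    (3, 12, 24), (3, 13, 23), (3, 14, 20), (3, 16, 24), (3, 17, 18), (3, 17, 19), (4, 5, 10),
    (4, 6, 13), (4, 6, 18), (4, 7, 18), (4, 7, 20), (4, 8, 14), (4, 8, 17), (4, 9, 21), (4, 9, 22),
    (4, 10, 11), (4, 11, 16), (4, 12, 20), (4, 13, 17), (4, 14, 22), (4, 15, 19), (4, 15, 23),
    (4, 16, 24), (4, 23, 24), (5, 6, 8), (5, 6, 19), (5, 7, 12), (5, 7, 16), (5, 8, 10),
    (5, 9, 20), (5, 11, 13), (5, 11, 19), (5, 12, 23), (5, 13, 21), (5, 14, 15), (5, 14, 22),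
    (5, 15, 24), (5, 16, 22), (5, 17, 23), (5, 17, 24), (5, 18, 20), (6, 7, 16), (6, 7, 19),
    (6, 8, 15), (6, 9, 11), (6, 9, 14), (6, 10, 21), (6, 11, 20), (6, 12, 15), (6, 12, 17),
    (6, 17, 22), (6, 18, 23), (6, 20, 24), (6, 22, 24), (7, 8, 9), (7, 8, 19), (7, 9, 10),
    (7, 12, 21), (7, 13, 15), (7, 13, 20), (7, 14, 24), (7, 17, 18), (7, 21, 23), (7, 22, 23),
    (8, 10, 23), (8, 11, 12), (8, 11, 14), (8, 12, 15), (8, 13, 18), (8, 17, 21), (8, 20, 23),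
    (8, 20, 24), (8, 21, 24), (9, 10, 15), (9, 12, 18), (9, 13, 16), (9, 14, 19), (9, 16, 23),
    (9, 17, 20), (9, 17, 24), (9, 18, 24), (9, 19, 23), (10, 12, 24), (10, 13, 18), (10, 14, 16),
    (10, 14, 23), (10, 16, 19), (10, 17, 20), (10, 18, 22), (10, 19, 20), (10, 21, 24),
    (11, 12, 22), (11, 13, 21), (11, 14, 17), (11, 15, 17), (11, 15, 23), (11, 18, 21),
    (11, 18, 22), (11, 19, 24), (12, 13, 17), (12, 13, 23), (12, 16, 21), (12, 18, 19),
    (12, 19, 22), (13, 14, 16), (13, 14, 20), (13, 15, 24), (13, 22, 24), (14, 15, 21),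
    (14, 17, 19), (14, 18, 21), (15, 16, 18), (15, 16, 20), (15, 17, 22), (15, 21, 22),
    (16, 18, 19), (16, 20, 23), (16, 21, 22), (19, 20, 21), (19, 22, 23)]
    (by decide) (by decide +kernel) (by decide +kernel) (by decide +kernel)

/-! ### Difference systems and their development -/

/-- Integer pairs `(a, b)` such that the triples `{x, x + a, x + b}` cover every difference of
absolute value between `1` and `k` exactly twice. -/
structure IsDifferenceSystem (k : ℕ) (P : Finset (ℤ × ℤ)) : Prop where
  bound : ∀ p ∈ P, |p.1| ≤ k
  ne_zero : ∀ p ∈ P, p.1 ≠ 0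
  swap : ∀ p ∈ P, (p.2, p.1) ∈ P
  shift : ∀ p ∈ P, (-p.1, p.2 - p.1) ∈ P
  two : ∀ a ∈ Finset.Icc (-k : ℤ) k, a ≠ 0 → ∃ b ∈ Finset.Icc (-k : ℤ) k,
    ∃ c ∈ Finset.Icc (-k : ℤ) k, b ≠ c ∧ (a, b) ∈ P ∧ (a, c) ∈ P ∧
      ∀ p ∈ P, p.1 = a → p.2 = b ∨ p.2 = c

theorem isDifferenceSystem_zero : IsDifferenceSystem 0 ∅ := by
  constructor <;> decide

/-- The pairs come from `{0, 1, 3}` and `{0, 2, 3}`, each based at each of its points in both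
orders. Each triple has the differences 1, 2, 3 once up to sign. -/
theorem isDifferenceSystem_three : IsDifferenceSystem 3
    {(1, 3), (1, -2), (2, 3), (2, -1), (3, 1), (3, 2), (-1, 2), (-1, -3), (-2, 1), (-2, -3),
      (-3, -2), (-3, -1)} := by
  constructor <;> decide

/-- The triples of a system of differences, developed modulo `n`. -/
def developed (n : ℕ) (P : Finset (ℤ × ℤ)) (x y z : ZMod n) : Prop :=
  ∃ p ∈ P, y = x + (p.1 : ZMod n) ∧ z = x + (p.2 : ZMod n)

section Developed

variable {n k : ℕ} {P : Finset (ℤ × ℤ)}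

/-- Integers in `[-k, k]` differ by at most `2k < n`, so integer difference systems can be read
modulo `n` without collisions. -/
theorem intCast_inj_of_abs (hk : 2 * k < n) {a b : ℤ} (ha : |a| ≤ k) (hb : |b| ≤ k)
    (h : (a : ZMod n) = b) : a = b := by
  rw [ZMod.intCast_eq_intCast_iff_dvd_sub] at h
  rw [abs_le] at ha hb
  have := Int.eq_zero_of_abs_lt_dvd h (by rw [abs_lt]; constructor <;> omega)
  omega

theorem developed_ne (hP : IsDifferenceSystem k P) (hk : 2 * k < n) {x y z : ZMod n}
    (h : developed n P x y z) : x ≠ y := by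
  obtain ⟨p, hp, rfl, -⟩ := h
  intro h
  exact hP.ne_zero p hp
    (intCast_inj_of_abs hk (hP.bound p hp) (by simp) (by rw [Int.cast_zero, ← left_eq_add.mp h]))

theorem developed_swap_left (hP : IsDifferenceSystem k P) {x y z : ZMod n}
    (h : developed n P x y z) : developed n P y x z := by
  obtain ⟨p, hp, rfl, rfl⟩ := h
  exact ⟨_, hP.shift p hp, by push_cast; ring, by push_cast; ring⟩

theorem developed_swap_right (hP : IsDifferenceSystem k P) {x y z : ZMod n}
    (h : developed n P x y z) : developed n P x z y := by
  obtain ⟨p, hp, rfl, rfl⟩ := h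
  exact ⟨_, hP.swap p hp, rfl, rfl⟩

/-- The residues of the integers of absolute value at most `k`. -/
noncomputable def smallResidues (n k : ℕ) : Finset (ZMod n) :=
  (Finset.Icc (-k : ℤ) k).image fun a : ℤ => (a : ZMod n)

theorem mem_smallResidues {d : ZMod n} :
    d ∈ smallResidues n k ↔ ∃ a : ℤ, |a| ≤ k ∧ (a : ZMod n) = d := by
  simp only [smallResidues, Finset.mem_image, Finset.mem_Icc, abs_le]

theorem card_smallResidues (hk : 2 * k < n) : (smallResidues n k).card = 2 * k + 1 := by
  rw [smallResidues, Finset.card_image_of_injOn, Int.card_Icc]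
  · omega
  · intro a ha b hb h
    rw [Finset.mem_coe, Finset.mem_Icc, ← abs_le] at ha hb
    exact intCast_inj_of_abs hk ha hb h

theorem neg_mem_smallResidues {d : ZMod n} (h : d ∈ smallResidues n k) :
    -d ∈ smallResidues n k := by
  obtain ⟨a, ha, rfl⟩ := mem_smallResidues.mp h
  exact mem_smallResidues.mpr ⟨-a, by rwa [abs_neg], by push_cast; rfl⟩

theorem developed_two (hP : IsDifferenceSystem k P) (hk : 2 * k < n) {x y : ZMod n}
    (hxy : x ≠ y) (h : y - x ∈ smallResidues n k) :
    ∃ p q, p ≠ q ∧ ∀ z, developed n P x y z ↔ z = p ∨ z = q := by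
  obtain ⟨a, ha, hax⟩ := mem_smallResidues.mp h
  obtain rfl : y = x + a := by rw [hax]; ring
  have ha0 : a ≠ 0 := by
    rintro rfl
    simp at hxy
  obtain ⟨b, hb, c, hc, hbc, hab, hac, hall⟩ := hP.two a (Finset.mem_Icc.mpr (abs_le.mp ha)) ha0
  rw [Finset.mem_Icc, ← abs_le] at hb hc
  refine ⟨x + b, x + c, fun h => hbc (intCast_inj_of_abs hk hb hc (add_left_cancel h)), fun z => ?_⟩
  constructor
  · rintro ⟨p, hp, h1, rfl⟩
    have h1 := intCast_inj_of_abs hk ha (hP.bound p hp) (add_left_cancel h1)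
    rcases hall p hp h1.symm with h | h <;> simp [h]
  · rintro (rfl | rfl)
    · exact ⟨_, hab, rfl, rfl⟩
    · exact ⟨_, hac, rfl, rfl⟩

theorem not_developed (hP : IsDifferenceSystem k P) {x y : ZMod n}
    (h : y - x ∉ smallResidues n k) (z : ZMod n) : ¬ developed n P x y z := by
  rintro ⟨p, hp, rfl, -⟩
  exact h (mem_smallResidues.mpr ⟨p.1, hP.bound p hp, by ring⟩)

end Developed

/-! ### The recursive construction and the induction -/

/-- The modulus is even, so parity is well defined on residues. Hence the cycles of step `o`
alternate in parity and split into two perfect matchings. -/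
theorem ZMod.even_val_add {m : ℕ} (x : ZMod (2 * m)) {o : ℕ} (ho : Odd o) (hom : o < 2 * m) :
    Even (x + (o : ZMod (2 * m))).val ↔ ¬ Even x.val := by
  have : NeZero (2 * m) := ⟨by omega⟩
  rw [ZMod.val_add, ZMod.val_cast_of_lt hom, Nat.even_iff, Nat.mod_mod_of_dvd _ ⟨m, rfl⟩,
    ← Nat.even_iff, Nat.even_add]
  simp [Nat.not_even_iff_odd.mpr ho]

/-- If `P` is a difference system for `k` and `o` is odd with `k < o < m`, a twofold triple system
on `w` points with `w + 2 * k + 1 = 2 * m` extends to one on `w + 2 * m` points. -/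
theorem PuncturedOrder.extend {w m k o : ℕ} (hw : PuncturedOrder w) {P : Finset (ℤ × ℤ)}
    (hP : IsDifferenceSystem k P) (ho : Odd o) (hko : k < o) (hom : o < m)
    (hm : w + 2 * k + 1 = 2 * m) : PuncturedOrder (w + 2 * m) := by
  obtain ⟨R, hR, hO⟩ := hw
  have : NeZero (2 * m) := ⟨by omega⟩
  have hk : 2 * k < 2 * m := by omega
  let A := smallResidues (2 * m) k
  -- Exactly `2m - (2k + 1) = w` differences remain, one label for each old point.
  have hcard : Fintype.card {d : ZMod (2 * m) // d ∉ A} = w := by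
    rw [Fintype.card_subtype_compl, ZMod.card, Fintype.card_coe, card_smallResidues hk]
    omega
  let e : {d : ZMod (2 * m) // d ∉ A} ≃ Fin w := Fintype.equivFinOfCardEq hcard
  have mem_A : ∀ t : ℕ, t ≤ m → k < t → (t : ZMod (2 * m)) ∉ A := by
    intro t htm hkt hmem
    obtain ⟨a, ha, hat⟩ := mem_smallResidues.mp hmem
    rw [← Int.cast_natCast t, ZMod.intCast_eq_intCast_iff_dvd_sub] at hat
    rw [abs_le] at ha
    have := Int.eq_zero_of_abs_lt_dvd hat (by rw [abs_lt]; push_cast; constructor <;> omega)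
    omega
  have h0 : (0 : ZMod (2 * m)) ∈ A := mem_smallResidues.mpr ⟨0, by simp, by simp⟩
  have hneg : ∀ d ∈ A, -d ∈ A := fun d hd => neg_mem_smallResidues hd
  let h : ZMod (2 * m) := (m : ZMod (2 * m))
  let u : ZMod (2 * m) := (o : ZMod (2 * m))
  have hhA : h ∉ A := mem_A m le_rfl (by omega)
  have huA : u ∉ A := mem_A o hom.le hko
  have hh : h + h = 0 := by
    have := ZMod.natCast_self (2 * m)
    push_cast at this
    rw [← this]
    ring
  have hh2 : ∀ d : ZMod (2 * m), d + d = 0 → d = 0 ∨ d = h := by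
    intro d hd
    have hlt := ZMod.val_lt d
    have hd' : ((2 * d.val : ℕ) : ZMod (2 * m)) = 0 := by
      push_cast
      rw [ZMod.natCast_zmod_val]
      linear_combination hd
    rw [ZMod.natCast_eq_zero_iff] at hd'
    obtain ⟨c, hc⟩ := Nat.dvd_of_mul_dvd_mul_left two_pos hd'
    have hc2 : c < 2 := by
      by_contra! hc2
      have := Nat.mul_le_mul_left m hc2
      omega
    rw [← ZMod.natCast_zmod_val d, hc]
    interval_cases c <;> simp [h]
  have hne : ∀ t s : ℕ, t < 2 * m → s < 2 * m → t ≠ s → (t : ZMod (2 * m)) ≠ s := by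
    intro t s ht hs hts he
    have := congrArg ZMod.val he
    rw [ZMod.val_cast_of_lt ht, ZMod.val_cast_of_lt hs] at this
    exact hts this
  have hhu : h ≠ u := hne m o (by omega) (by omega) (by omega)
  have hhu' : h ≠ -u := fun he => hhu (by
    rw [← neg_neg u, ← he, eq_neg_iff_add_eq_zero, hh])
  let ε : ZMod (2 * m) → ZMod (2 * m) := fun x => if Even x.val then u else -u
  have hε : ∀ x, ε x = u ∨ ε x = -u := fun x => by
    simp only [ε]; split_ifs <;> simp
  have hadd : ∀ x, ε (x + u) = -ε x := fun x => by
    simp only [ε, u, ZMod.even_val_add x ho (by omega)]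
    split_ifs <;> simp
  have hsub : ∀ x, ε (x - u) = -ε x := fun x => by
    rw [← neg_neg (ε (x - u)), ← hadd, sub_add_cancel]
  have d0 : ∀ d : {d // d ∉ A}, d.1 ≠ 0 := fun d hd => d.2 (hd ▸ h0)
  have hext := hR.extend (S := developed (2 * m) P)
    (F := fun a x y => differenceGraph h u ε (e.symm a).1 x y)
    (developed_ne hP hk) (developed_swap_left hP) (developed_swap_right hP)
    (differenceGraph_ne (ne_of_mem_of_not_mem h0 hhA).symm (ne_of_mem_of_not_mem h0 huA).symm hε
      (d0 _))
    (differenceGraph_symm hh hε hadd hsub)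
    (fun a x => differenceGraph_two hh2 hhu hhu' hε (d0 _) x)
    (fun x y hxy => by
      by_cases hA : y - x ∈ A
      · obtain ⟨p, q, hpq, hall⟩ := developed_two hP hk hxy hA
        exact .inl ⟨p, q, hpq, hall, fun a => not_differenceGraph_of_mem (A := (A : Set _))
          hneg huA hhA hε (e.symm a).2 hA⟩
      · obtain ⟨p, q, hpq, hall⟩ := differenceGraph_cover (A := (A : Set (ZMod (2 * m)))) hneg h0
          huA hhA hh hh2 hhu hhu' hε hA
        exact .inr ⟨e p, e q, e.injective.ne hpq, fun a =>
          (hall (e.symm a)).trans (by simp only [e.symm_apply_eq]), not_developed hP hA⟩)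
  exact .of_card hext (hO.of_embedding Sum.inl_injective fun _ _ _ => Iff.rfl)
    (by simp [ZMod.card])

theorem puncturedOrder_of_mod_six {v : ℕ} (hmod : v % 6 = 1 ∨ v % 6 = 3) (hv : 13 ≤ v) :
    PuncturedOrder v := by
  induction v using Nat.strong_induction_on with
  | _ v ih =>
    by_cases hsmall : v = 13 ∨ v = 15 ∨ v = 19 ∨ v = 21 ∨ v = 25
    · rcases hsmall with rfl | rfl | rfl | rfl | rfl
      · exact puncturedOrder_13
      · exact puncturedOrder_15
      · exact puncturedOrder_19
      · exact puncturedOrder_21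
      · exact puncturedOrder_25
    -- For `w` congruent to 1 or 3 modulo 6, `2w + 1` is 3 or 7 modulo 12 and `2w + 7` is 9 or 1.
    -- The explicit orders are those for which the required `w` would fall below 13.
    by_cases h12 : v % 12 = 3 ∨ v % 12 = 7
    · obtain ⟨w, rfl⟩ : ∃ w, v = 2 * w + 1 := ⟨v / 2, by omega⟩
      have := (ih w (by omega) (by omega) (by omega)).extend (m := (w + 1) / 2)
        isDifferenceSystem_zero odd_one one_pos (by omega) (by omega)
      rwa [show w + 2 * ((w + 1) / 2) = 2 * w + 1 by omega] at this
    · obtain ⟨w, rfl⟩ : ∃ w, v = 2 * w + 7 := ⟨(v - 7) / 2, by omega⟩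
      have := (ih w (by omega) (by omega) (by omega)).extend (m := (w + 7) / 2) (o := 5)
        isDifferenceSystem_three (by decide) (by omega) (by omega) (by omega)
      rwa [show w + 2 * ((w + 7) / 2) = 2 * w + 7 by omega] at this

theorem mainTheorem5 (v : ℕ) (hmod : v % 6 = 1 ∨ v % 6 = 3) (hv : 15 ≤ v) :
    ∃ blocks : Finset (Finset (Fin v)),
      IsBlockDesign 2 v 3 2 blocks ∧ gammaTwo blocks = 3 := by
  obtain ⟨R, hR, hO⟩ := puncturedOrder_of_mod_six hmod (by omega)
  refine ⟨tripleBlocks R, ?_, hR.gammaTwo_tripleBlocks hO⟩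
  simpa using hR.isBlockDesign
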